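/- Let $N>1$ be an integer, $N_1=\lfloor (N-1)/2\rfloor$, $N_2=\lfloor N/2\rfloor$, and for $x\in\mathbb Z$ let $\widetilde x$ be the unique integer with $\widetilde x\equiv x \pmod N$ and $-N_1\le \widetilde x\le N_2$. Let $\Gamma(N)<\Gamma_1(N)<\Gamma_0(N)<\mathrm{SL}_2(\mathbb Z)$ be the usual congruence subgroups, and let $$T=\begin{pmatrix}1&1\\0&1\end{pmatrix},\qquad S=\begin{pmatrix}0&-1\\1&0\end{pmatrix},\qquad D=\{z\in\mathbb H : |z|>1,\ |\operatorname{Re} z|<\tfrac12\}.$$ A *fundamental domain* for a subgroup $\Gamma$ of $\mathrm{SL}_2(\mathbb Z)$ is an open connected set $F\subset\mathbb H$ such that no two distinct points of $F$ are equivalent under $\Gamma$ and every point of $\mathbb H$ is equivalent under $\Gamma$ to a point of $\overline F$ (closures are taken in $\mathbb H$). A finite list $\gamma_1,\dots,\gamma_n$ in $\mathrm{SL}_2(\mathbb Z)$ is a *fundamental list of right coset representatives* for $\Gamma$ if every right coset $(\pm I)\Gamma g$ of $(\pm I)\Gamma$ in $\mathrm{SL}_2(\mathbb Z)$ contains $\gamma_i$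 for exactly one index $i$, and $\operatorname{Int}\big(\bigcup_{i=1}^n\overline{\gamma_iD}\big)$ is connected. Let $P^1(\mathbb Z/N)$ be the set of pairs $(a,b)$ in $\mathbb Z/N$ with $\gcd(a,b,N)=1$, modulo multiplication by units; write $(a:b)$ for the class of $(a,b)$, and let $H$ be the set of the classes $(a:b)$ with $\gcd(a,N)>1$. For $(a:b)\in H$ put $$M(a:b)=\min\{m\in\mathbb Z_{\ge0} : \gcd(ma-b,N)=1\},\qquad \operatorname{pr}(a:b)=(ac^{-1},bc^{-1})\ \text{ with } c=M(a:b)\,a-b\in(\mathbb Z/N)^*;$$ both depend only on the class. For $j$ with $\gcd(j,N)>1$ let $M_j$ be the maximum of $M(a:b)$ over all $(a:b)\in H$ for which the first coordinate of $\operatorname{pr}(a:b)$ is $j \bmod N$. In what follows $i,\ell$ run through the integers in $[-N_1,N_2]$; $j$ through the integers in $[-N_1,N_2]$ with $\gcd(j,N)>1$; $m$, for given $j$, through $0\le m\le M_j$; and $k$ through the integers with $-N_1\le k\le-2$ and $\gcd(k,N)=1$; $k^{-1}$ is an integer inverse of $k$ modulo $N$. 1. The list $\Theta_0$ consisting of all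 $ST^i$ and all $ST^jST^m$ is a fundamental list of right coset representatives for $\Gamma_0(N)$. 2. The list $\Theta_1$ consisting of all $ST^i$, all $ST^jST^m$, all $ST^kST^i$ and all $ST^kST^{\widetilde{k^{-1}+j}}ST^m$ is a fundamental list of right coset representatives for $\Gamma_1(N)$. 3. The list of all products $T^\ell\gamma$ with $\gamma\in\Theta_1$ is a fundamental list of right coset representatives for $\Gamma(N)$. In each case the set $\operatorname{Int}\big(\bigcup_\gamma\overline{\gamma D}\big)$, with $\gamma$ running through the list, is a fundamental domain for the subgroup concerned. -/

import Mathlib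

noncomputable section

namespace ConnFund

open MatrixGroups UpperHalfPlane

/-! ### Fundamental domains and fundamental lists -/

/-- Fundamental domain in the sense of Shimura for a subgroup `Γ` of `SL(2, ℤ)`
(closure taken in `ℍ`): `F` is open and connected, distinct points of `F` are inequivalent
under `Γ`, and every point of `ℍ` is equivalent under `Γ` to a point of the closure of `F`. -/
structure IsFundamentalDomain (Γ : Subgroup SL(2, ℤ)) (F : Set ℍ) : Prop where
  isOpen : IsOpen F
  isConnected : IsConnected F
  eq_of_equiv : ∀ x ∈ F, ∀ y ∈ F, (∃ γ ∈ Γ, γ • x = y) → x = y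
  exists_mem_closure : ∀ x : ℍ, ∃ y ∈ closure F, ∃ γ ∈ Γ, γ • x = y

/-- The subgroup `(±I)Γ` of `SL(2, ℤ)`. -/
def pm (Γ : Subgroup SL(2, ℤ)) : Subgroup SL(2, ℤ) where
  carrier := {g | g ∈ Γ ∨ -g ∈ Γ}
  one_mem' := Or.inl Γ.one_mem
  mul_mem' := by
    rintro a b (ha | ha) (hb | hb)
    · exact Or.inl (Γ.mul_mem ha hb)
    · exact Or.inr (by simpa using Γ.mul_mem ha hb)
    · exact Or.inr (by simpa using Γ.mul_mem ha hb)
    · exact Or.inl (by simpa using Γ.mul_mem ha hb)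
  inv_mem' := by
    rintro a (ha | ha)
    · exact Or.inl (Γ.inv_mem ha)
    · refine Or.inr ?_
      have h : (-a)⁻¹ = -a⁻¹ := inv_eq_of_mul_eq_one_left (by simp)
      exact h ▸ Γ.inv_mem ha

/-- The list `θ` contains exactly one element, listed exactly once, of each right coset
`(±I)Γ g`. -/
def IsRightCosetReps (Γ : Subgroup SL(2, ℤ)) {ι : Type} (θ : ι → SL(2, ℤ)) : Prop :=
  Function.Bijective
    (fun i => (Quotient.mk (QuotientGroup.rightRel (pm Γ)) (θ i) :
      Quotient (QuotientGroup.rightRel (pm Γ))))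

/-- The interior of the union of the closures of the translates `θ i • D`, where
`D = {z ∈ ℍ : |z| > 1, |Re z| < 1/2}` is `ModularGroup.fdo`. -/
def domain {ι : Type} (θ : ι → SL(2, ℤ)) : Set ℍ :=
  interior (⋃ i, closure ((fun z : ℍ => θ i • z) '' ModularGroup.fdo))

/-- A fundamental list of right coset representatives: the domain attached to it is connected. -/
structure IsFundamentalList (Γ : Subgroup SL(2, ℤ)) {ι : Type} (θ : ι → SL(2, ℤ)) : Prop where
  reps : IsRightCosetReps Γ θ
  connected : IsConnected (domain θ)

/-! ### The projective line over `ℤ/N` and the numbers `M_j` -/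

/-- `gcd(a, N)` for a residue class `a` modulo `N`. -/
def gcdN (N : ℕ) (a : ZMod N) : ℕ := Nat.gcd a.val N

/-- Pairs `(a, b)` of residues modulo `N` with `gcd(a, b, N) = 1`. -/
def Pair (N : ℕ) : Type :=
  {p : ZMod N × ZMod N // Nat.gcd (Nat.gcd p.1.val p.2.val) N = 1}

/-- `(a, b) ∼ (a', b')` if `a = u a'` and `b = u b'` for a unit `u`. -/
def pairSetoid (N : ℕ) : Setoid (Pair N) where
  r p q := ∃ u : (ZMod N)ˣ, p.1.1 = u * q.1.1 ∧ p.1.2 = u * q.1.2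
  iseqv :=
    { refl := fun p => ⟨1, by simp⟩
      symm := by
        rintro p q ⟨u, h1, h2⟩
        exact ⟨u⁻¹, by rw [h1]; simp, by rw [h2]; simp⟩
      trans := by
        rintro p q r ⟨u, h1, h2⟩ ⟨v, h3, h4⟩
        exact ⟨u * v, by rw [h1, h3]; simp [mul_assoc], by rw [h2, h4]; simp [mul_assoc]⟩ }

/-- The projective line `P¹(ℤ/N)`. -/
def P1 (N : ℕ) : Type := Quotient (pairSetoid N)

/-- The class `(a : b)`. -/
def P1.mk {N : ℕ} (p : Pair N) : P1 N := Quotient.mk (pairSetoid N) p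

/-- The points at infinity: the classes `(a : b)` with `gcd(a, N) > 1`. -/
def infinityPts (N : ℕ) : Set (P1 N) :=
  {P | ∃ p : Pair N, P1.mk p = P ∧ 1 < gcdN N p.1.1}

theorem gcdN_eq_one_iff {N : ℕ} [NeZero N] (a : ZMod N) : gcdN N a = 1 ↔ IsUnit a := by
  conv_rhs => rw [← ZMod.natCast_zmod_val a, ZMod.isUnit_iff_coprime]
  rfl

/-- `min {m ≥ 0 : gcd(m a - b, N) = 1}` for a pair `(a, b)`. -/
def Mpair {N : ℕ} (p : Pair N) : ℕ :=
  sInf {m : ℕ | gcdN N ((m : ZMod N) * p.1.1 - p.1.2) = 1}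

/-- The set whose minimum is `Mpair p` is never empty. -/
theorem exists_unit {N : ℕ} [NeZero N] (p : Pair N) :
    {m : ℕ | gcdN N ((m : ZMod N) * p.1.1 - p.1.2) = 1}.Nonempty := by
  classical
  obtain ⟨⟨a, b⟩, h⟩ := p
  have hdvd : ∀ (q : ℕ) (hq : q ∣ N) (c : ZMod N), q ∣ c.val ↔ ZMod.castHom hq (ZMod q) c = 0 := by
    intro q hq c
    rw [← ZMod.natCast_eq_zero_iff]
    conv_rhs => rw [← ZMod.natCast_zmod_val c, map_natCast]
  set m : ℕ := ∏ q ∈ N.primeFactors.filter (fun q => ¬ q ∣ b.val), q with hm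
  refine ⟨m, ?_⟩
  change Nat.Coprime _ N
  refine Nat.Coprime.symm (Nat.coprime_of_dvd ?_)
  intro q hq hqN hq'
  have : Fact q.Prime := ⟨hq⟩
  have hqm : q ∣ m ↔ ¬ q ∣ b.val := by
    constructor
    · intro hd hb
      obtain ⟨r, hr, hqr⟩ := (Nat.Prime.prime hq).exists_mem_finset_dvd hd
      rw [Finset.mem_filter, Nat.mem_primeFactors] at hr
      have := (Nat.prime_dvd_prime_iff_eq hq hr.1.1).1 hqr
      subst this
      exact hr.2 hb
    · intro hb
      exact Finset.dvd_prod_of_mem (fun q => q)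
        (Finset.mem_filter.2 ⟨Nat.mem_primeFactors.2 ⟨hq, hqN, NeZero.ne N⟩, hb⟩)
  rw [hdvd q hqN, map_sub, map_mul, map_natCast] at hq'
  by_cases hb : q ∣ b.val
  · have h1 : ¬ q ∣ m := fun h => hqm.1 h hb
    have h2 := (hdvd q hqN b).1 hb
    change _ - ZMod.castHom hqN (ZMod q) b = 0 at hq'
    rw [h2, sub_zero, mul_eq_zero, ZMod.natCast_eq_zero_iff] at hq'
    have h3 := (hdvd q hqN a).2 (hq'.resolve_left h1)
    have : q ∣ 1 := h ▸ Nat.dvd_gcd (Nat.dvd_gcd h3 hb) hqN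
    exact hq.one_lt.ne' (Nat.dvd_one.1 this)
  · have h1 := (ZMod.natCast_eq_zero_iff m q).2 (hqm.2 hb)
    rw [h1, zero_mul, zero_sub, neg_eq_zero] at hq'
    exact hb ((hdvd q hqN b).2 hq')

theorem Mpair_congr {N : ℕ} [NeZero N] {p q : Pair N} (h : pairSetoid N p q) :
    Mpair p = Mpair q := by
  obtain ⟨u, h1, h2⟩ := h
  unfold Mpair
  congr 1
  ext m
  have : (m : ZMod N) * p.1.1 - p.1.2 = u * ((m : ZMod N) * q.1.1 - q.1.2) := by
    rw [h1, h2]; ring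
  simp only [Set.mem_ofPred_eq, gcdN_eq_one_iff, this, Units.isUnit_units_mul]

/-- The function `M(a : b) = min {m ≥ 0 : gcd(m a - b, N) = 1}`. -/
def Mfun {N : ℕ} [NeZero N] : P1 N → ℕ :=
  Quotient.lift Mpair (fun _ _ h => Mpair_congr h)

/-- The preferred representative of the class of a pair `(a, b)`: it is `(1, a⁻¹ b)` if
`gcd(a, N) = 1`, and otherwise `(a c⁻¹, b c⁻¹)` with `c = M(a : b) a - b`. -/
def prPair {N : ℕ} (p : Pair N) : ZMod N × ZMod N :=
  if gcdN N p.1.1 = 1 then (1, p.1.1⁻¹ * p.1.2)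
  else (p.1.1 * ((Mpair p : ZMod N) * p.1.1 - p.1.2)⁻¹,
    p.1.2 * ((Mpair p : ZMod N) * p.1.1 - p.1.2)⁻¹)

theorem inv_unit_mul {N : ℕ} (u : (ZMod N)ˣ) {c : ZMod N} (hc : IsUnit c) :
    ((u : ZMod N) * c)⁻¹ = (u⁻¹ : (ZMod N)ˣ) * c⁻¹ := by
  obtain ⟨v, rfl⟩ := hc
  rw [← Units.val_mul, ZMod.inv_coe_unit, ZMod.inv_coe_unit, ← Units.val_mul, mul_inv]

theorem prPair_congr {N : ℕ} [NeZero N] {p q : Pair N} (h : pairSetoid N p q) :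
    prPair p = prPair q := by
  have hM := Mpair_congr h
  obtain ⟨u, h1, h2⟩ := h
  have hc : IsUnit ((Mpair q : ZMod N) * q.1.1 - q.1.2) :=
    (gcdN_eq_one_iff _).1 (Nat.sInf_mem (exists_unit q))
  have hpc : (Mpair q : ZMod N) * p.1.1 - p.1.2
      = u * ((Mpair q : ZMod N) * q.1.1 - q.1.2) := by rw [h1, h2]; ring
  have hu : (u : ZMod N) * (u⁻¹ : (ZMod N)ˣ) = 1 := by simp
  have key : ∀ x y : ZMod N, u * x * ((u⁻¹ : (ZMod N)ˣ) * y) = x * y := by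
    intro x y
    linear_combination (x * y) * hu
  unfold prPair
  simp only [gcdN_eq_one_iff]
  by_cases hq : IsUnit q.1.1
  · have hp : IsUnit p.1.1 := by rw [h1]; exact u.isUnit.mul hq
    rw [if_pos hp, if_pos hq, h1, h2, inv_unit_mul u hq, mul_comm _ ((u : ZMod N) * _), key,
      mul_comm]
  · have hp : ¬ IsUnit p.1.1 := by rw [h1]; simpa using hq
    rw [if_neg hp, if_neg hq, hM, hpc, inv_unit_mul u hc, h1, h2, key, key]

/-- The map `pr` which picks the preferred representative of each class of `P¹(ℤ/N)`. -/
def pr {N : ℕ} [NeZero N] : P1 N → ZMod N × ZMod N :=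
  Quotient.lift prPair (fun _ _ h => prPair_congr h)

/-- `M_j = max {M(a : b) : (a : b) at infinity, j = π₁(pr(a : b))}`. -/
def Mj (N : ℕ) [NeZero N] (j : ZMod N) : ℕ :=
  sSup (Mfun '' {P : P1 N | P ∈ infinityPts N ∧ (pr P).1 = j})

/-- The supremum defining `M_j` is the maximum of a nonempty bounded set. -/
theorem Mj_isGreatest {N : ℕ} [NeZero N] (j : ZMod N) (hj : 1 < gcdN N j) :
    IsGreatest (Mfun '' {P : P1 N | P ∈ infinityPts N ∧ (pr P).1 = j}) (Mj N j) := by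
  have : Finite (Pair N) := Subtype.finite
  have : Finite (P1 N) := Quotient.finite _
  have hcop : Nat.Coprime (-1 : ZMod N).val N := (gcdN_eq_one_iff _).2 isUnit_one.neg
  let p : Pair N := ⟨(j, -1), Nat.Coprime.coprime_dvd_left (Nat.gcd_dvd_right _ _) hcop⟩
  have hM : Mpair p = 0 := by
    refine Nat.sInf_eq_zero.2 (Or.inl ?_)
    change gcdN N (((0 : ℕ) : ZMod N) * j - -1) = 1
    rw [gcdN_eq_one_iff]
    simp
  have hpr : (prPair p).1 = j := by
    have h1 : ¬ gcdN N p.1.1 = 1 := hj.ne'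
    have h2 : (1 : ZMod N)⁻¹ = 1 := ZMod.inv_one N
    unfold prPair
    rw [if_neg h1, hM]
    simp [p, h2]
  refine ⟨Nat.sSup_mem ⟨_, P1.mk p, ⟨⟨p, rfl, hj⟩, hpr⟩, rfl⟩ (Set.toFinite _).bddAbove,
    fun m hm => le_csSup (Set.toFinite _).bddAbove hm⟩

/-! ### The lists -/

/-- `N₁ = ⌊(N - 1) / 2⌋`. -/
def N1 (N : ℕ) : ℤ := ((N : ℤ) - 1) / 2

/-- `N₂ = ⌊N / 2⌋`. -/
def N2 (N : ℕ) : ℤ := (N : ℤ) / 2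

/-- The residue `x̃` of `x` modulo `N` with `-N₁ ≤ x̃ ≤ N₂`. -/
def tilde (N : ℕ) (x : ℤ) : ℤ := (x + N1 N) % (N : ℤ) - N1 N

/-- `tilde N x` is the unique integer congruent to `x` modulo `N` in `[-N₁, N₂]`. -/
theorem tilde_eq_iff {N : ℕ} (hN : 0 < N) (x y : ℤ) :
    tilde N x = y ↔ y ≡ x [ZMOD N] ∧ -N1 N ≤ y ∧ y ≤ N2 N := by
  have h12 : N1 N + N2 N = (N : ℤ) - 1 := by unfold N1 N2; omega
  have hN' : (0 : ℤ) < N := by exact_mod_cast hN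
  unfold tilde
  constructor
  · rintro rfl
    have h1 := Int.emod_nonneg (x + N1 N) hN'.ne'
    have h2 := Int.emod_lt_of_pos (x + N1 N) hN'
    refine ⟨?_, by linarith, by linarith⟩
    simpa using (Int.mod_modEq (x + N1 N) N).sub_right (N1 N)
  · rintro ⟨h, h1, h2⟩
    have h3 : (y + N1 N) % N = (x + N1 N) % N := h.add_right (N1 N)
    rw [← h3, Int.emod_eq_of_lt (by linarith) (by linarith)]
    ring

/-- The indices `i` with `-N₁ ≤ i ≤ N₂`. -/
def ResIdx (N : ℕ) : Type := {i : ℤ // -N1 N ≤ i ∧ i ≤ N2 N}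

/-- The indices `(j, m)` with `-N₁ ≤ j ≤ N₂`, `gcd(j, N) > 1` and `0 ≤ m ≤ M_j`. -/
def InfIdx (N : ℕ) [NeZero N] : Type :=
  {q : ℤ × ℕ // (-N1 N ≤ q.1 ∧ q.1 ≤ N2 N) ∧ 1 < Int.gcd q.1 N ∧ q.2 ≤ Mj N (q.1 : ZMod N)}

/-- The indices `k` with `-N₁ ≤ k ≤ -2` and `gcd(k, N) = 1`. -/
def UnitIdx (N : ℕ) : Type := {k : ℤ // (-N1 N ≤ k ∧ k ≤ -2) ∧ Int.gcd k N = 1}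

/-- An integer inverse modulo `N` of an integer `k` prime to `N`. -/
def kinv (N : ℕ) (k : ℤ) : ℤ := (((k : ZMod N)⁻¹).val : ℤ)

open ModularGroup in
/-- The list `Θ₀`: the words `S T^i` and `S T^j S T^m`. -/
def theta0 (N : ℕ) [NeZero N] : ResIdx N ⊕ InfIdx N → SL(2, ℤ)
  | .inl i => S * T ^ i.1
  | .inr q => S * T ^ q.1.1 * S * T ^ q.1.2

open ModularGroup in
/-- The list `Θ₁`: the list `Θ₀`, followed by the words `S T^k S T^i` and
`S T^k S T^(tilde(k⁻¹ + j)) S T^m`. -/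
def theta1 (N : ℕ) [NeZero N] :
    (ResIdx N ⊕ InfIdx N) ⊕ (UnitIdx N × ResIdx N ⊕ UnitIdx N × InfIdx N) → SL(2, ℤ)
  | .inl x => theta0 N x
  | .inr (.inl (k, i)) => S * T ^ k.1 * S * T ^ i.1
  | .inr (.inr (k, q)) =>
      S * T ^ k.1 * S * T ^ tilde N (kinv N k.1 + q.1.1) * S * T ^ q.1.2

open ModularGroup in
/-- The list of all products `T^ℓ γ` with `-N₁ ≤ ℓ ≤ N₂` and `γ` in the list `Θ₁`. -/
def thetaFull (N : ℕ) [NeZero N] :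
    ResIdx N × ((ResIdx N ⊕ InfIdx N) ⊕ (UnitIdx N × ResIdx N ⊕ UnitIdx N × InfIdx N)) →
      SL(2, ℤ) :=
  fun x => T ^ x.1.1 * theta1 N x.2

end ConnFund

end

namespace ConnFund

open MatrixGroups UpperHalfPlane ModularGroup Topology

/-! ### Translates of the standard fundamental domain -/

/-! Right cosets are read off from bottom rows modulo `N`. The coset of `g` modulo (±I)Γ₁(N) is its
row up to sign, and modulo (±I)Γ₀(N) it is its row up to a unit (`mul_inv_mem_pm_Gamma1_iff`,
`mul_inv_mem_pm_Gamma0_iff`). The words in Θ₀ have rows (1, i) and (j, mj - 1). Every row is a unit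
times exactly one of these, and the unit is unique (`exists_eq_smul_baseRow`,
`smul_baseRow_injective`): if a is not a unit and c = M(a:b)a - b, then (a, b) = c(j, mj - 1) with j
= a/c and m = M(a:b).

This settles Γ₀(N). For Γ₁(N) one needs each such row times each unit modulo sign. The units modulo
sign are represented by -1 and the admissible k, and the words of Θ₁ realise exactly these multiples
(`row_theta1`). For Γ(N), the powers T^ℓ represent the cosets of (±I)Γ(N) in (±I)Γ₁(N).

Connectedness holds because gD shares an edge with gTD and with gSD, and each word can be built up
letter by letter without leaving the list (`linked_theta0`, `linked_theta1`). That a fundamental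
list yields a fundamental domain is general: only ±I moves a point of D into its closure. -/

/-- The translate `g • D` of the standard open fundamental domain. -/
def tile (g : SL(2, ℤ)) : Set ℍ := (fun z : ℍ => g • z) '' fdo

theorem S_mul_S : (S * S : SL(2, ℤ)) = -1 := by decide

theorem continuous_smul_sl (g : SL(2, ℤ)) : Continuous (fun z : ℍ => g • z) := by
  simp only [sl_moeb]
  exact continuous_const_smul _

/-- The action of an element of `SL(2, ℤ)` on `ℍ` as a homeomorphism. -/
noncomputable def smulHomeo (g : SL(2, ℤ)) : ℍ ≃ₜ ℍ where
  toEquiv := MulAction.toPerm g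
  continuous_toFun := continuous_smul_sl g
  continuous_invFun := continuous_smul_sl g⁻¹

theorem mem_tile {g : SL(2, ℤ)} {z : ℍ} : z ∈ tile g ↔ g⁻¹ • z ∈ fdo := by
  constructor
  · rintro ⟨w, hw, rfl⟩
    simpa using hw
  · intro h
    exact ⟨_, h, by simp⟩

theorem closure_tile (g : SL(2, ℤ)) : closure (tile g) = (fun z : ℍ => g • z) '' fd := by
  rw [fd_eq_closure_fdo]
  exact ((smulHomeo g).image_closure fdo).symm

theorem mem_closure_tile {g : SL(2, ℤ)} {z : ℍ} : z ∈ closure (tile g) ↔ g⁻¹ • z ∈ fd := by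
  rw [closure_tile]
  constructor
  · rintro ⟨w, hw, rfl⟩
    simpa using hw
  · intro h
    exact ⟨_, h, by simp⟩

theorem isOpen_tile (g : SL(2, ℤ)) : IsOpen (tile g) :=
  (smulHomeo g).isOpenMap _ isOpen_fdo

/-- In the coordinates x = Re z, t = |z|² - 1 the domain is the box (-1/2, 1/2) × (0, ∞), hence a
continuous image of a connected set. -/
theorem isPreconnected_fdo : IsPreconnected fdo := by
  have him : ∀ q : ℝ × ℝ, q ∈ Set.Ioo (-(1 / 2) : ℝ) (1 / 2) ×ˢ Set.Ioi (0 : ℝ) →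
      0 < 1 - q.1 ^ 2 + q.2 := by
    rintro ⟨x, t⟩ ⟨⟨h1, h2⟩, h3⟩
    simp only [Set.mem_Ioi] at h1 h2 h3 ⊢
    nlinarith
  let f : (Set.Ioo (-(1 / 2) : ℝ) (1 / 2) ×ˢ Set.Ioi (0 : ℝ) : Set (ℝ × ℝ)) → ℍ :=
    fun q => UpperHalfPlane.mk ⟨q.1.1, √(1 - q.1.1 ^ 2 + q.1.2)⟩ (Real.sqrt_pos.2 (him _ q.2))
  have hf : Continuous f := by
    apply Continuous.upperHalfPlaneMk
    simp_rw [Complex.mk_eq_add_mul_I]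
    fun_prop
  have hconn : IsPreconnected (Set.Ioo (-(1 / 2) : ℝ) (1 / 2) ×ˢ Set.Ioi (0 : ℝ)) :=
    isPreconnected_Ioo.prod isPreconnected_Ioi
  have hsub := isPreconnected_iff_preconnectedSpace.1 hconn
  convert! isPreconnected_range hf
  ext z
  constructor
  · rintro ⟨h1, h2⟩
    rw [Complex.normSq_apply] at h1
    simp only [coe_re, coe_im] at h1
    have ht : 0 < z.re * z.re + z.im * z.im - 1 := by linarith
    refine ⟨⟨(z.re, z.re * z.re + z.im * z.im - 1), abs_lt.1 h2, ht⟩, ext_re_im rfl ?_⟩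
    change √(1 - z.re ^ 2 + (z.re * z.re + z.im * z.im - 1)) = z.im
    rw [show 1 - z.re ^ 2 + (z.re * z.re + z.im * z.im - 1) = z.im ^ 2 by ring]
    exact Real.sqrt_sq z.im_pos.le
  · rintro ⟨⟨⟨x, t⟩, hq⟩, rfl⟩
    have hpos := him _ hq
    refine ⟨?_, abs_lt.2 hq.1⟩
    change 1 < Complex.normSq ⟨x, √(1 - x ^ 2 + t)⟩
    rw [Complex.normSq_mk, Real.mul_self_sqrt hpos.le]
    have : 0 < t := hq.2
    nlinarith

theorem isPreconnected_tile (g : SL(2, ℤ)) : IsPreconnected (tile g) :=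
  isPreconnected_fdo.image _ (continuous_smul_sl g).continuousOn

theorem fdo_nonempty : fdo.Nonempty := by
  refine Set.nonempty_iff_ne_empty.2 fun h => ?_
  have := fd_eq_closure_fdo ▸ I_mem_fd
  simp [h] at this

theorem tile_nonempty (g : SL(2, ℤ)) : (tile g).Nonempty := fdo_nonempty.image _

/-! ### Connectedness of the domain of a list -/

/-- The union of the closures of the tiles of a list. -/
def covered {ι : Type} (θ : ι → SL(2, ℤ)) : Set ℍ := ⋃ i, closure (tile (θ i))

theorem domain_eq {ι : Type} (θ : ι → SL(2, ℤ)) : domain θ = interior (covered θ) := rfl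

theorem closure_tile_subset_covered {ι : Type} (θ : ι → SL(2, ℤ)) (i : ι) :
    closure (tile (θ i)) ⊆ covered θ :=
  Set.subset_iUnion (fun i => closure (tile (θ i))) i

theorem tile_subset_domain {ι : Type} (θ : ι → SL(2, ℤ)) (i : ι) : tile (θ i) ⊆ domain θ :=
  interior_maximal (subset_closure.trans (closure_tile_subset_covered θ i)) (isOpen_tile _)

/-- The tiles of `g` and `h` lie in a common connected subset of the domain of `θ`. -/
def Linked {ι : Type} (θ : ι → SL(2, ℤ)) (g h : SL(2, ℤ)) : Prop :=
  ∃ C ⊆ domain θ, IsPreconnected C ∧ tile g ⊆ C ∧ tile h ⊆ C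

section Linked

variable {ι : Type} {θ : ι → SL(2, ℤ)} {g h k : SL(2, ℤ)}

theorem Linked.symm (H : Linked θ g h) : Linked θ h g := by
  obtain ⟨C, h1, h2, h3, h4⟩ := H
  exact ⟨C, h1, h2, h4, h3⟩

theorem Linked.trans (H : Linked θ g h) (H' : Linked θ h k) : Linked θ g k := by
  obtain ⟨C, h1, h2, h3, h4⟩ := H
  obtain ⟨C', h1', h2', h3', h4'⟩ := H'
  obtain ⟨x, hx⟩ := tile_nonempty h
  exact ⟨C ∪ C', Set.union_subset h1 h1', h2.union x (h4 hx) (h3' hx) h2',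
    h3.trans Set.subset_union_left, h4'.trans Set.subset_union_right⟩

theorem linked_refl (hg : closure (tile g) ⊆ covered θ) : Linked θ g g :=
  ⟨_, interior_maximal (subset_closure.trans hg) (isOpen_tile g), isPreconnected_tile g,
    subset_rfl, subset_rfl⟩

/-- Two tiles are linked if their closures together are a neighbourhood of a common point. -/
theorem linked_mul_of_nhds {s : SL(2, ℤ)} {p : ℍ} (hp : p ∈ fd) (hp' : p ∈ closure (tile s))
    (hn : fd ∪ closure (tile s) ∈ 𝓝 p) (hg : closure (tile g) ⊆ covered θ)
    (hgs : closure (tile (g * s)) ⊆ covered θ) : Linked θ g (g * s) := by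
  have himg : ∀ z, z ∈ closure (tile s) → g • z ∈ closure (tile (g * s)) := by
    intro z hz
    rw [mem_closure_tile] at hz ⊢
    simpa [mul_smul] using hz
  have himg' : ∀ z, z ∈ fd → g • z ∈ closure (tile g) := by
    intro z hz
    rw [mem_closure_tile]
    simpa using hz
  have hdom : ∀ h, closure (tile h) ⊆ covered θ → tile h ⊆ domain θ := fun h hh =>
    interior_maximal (subset_closure.trans hh) (isOpen_tile _)
  have hmem : g • p ∈ domain θ := by
    rw [domain_eq, mem_interior_iff_mem_nhds]
    refine Filter.mem_of_superset ((smulHomeo g).isOpenMap.image_mem_nhds hn) ?_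
    rintro _ ⟨z, hz | hz, rfl⟩
    · exact hg (himg' z hz)
    · exact hgs (himg z hz)
  have hpre : ∀ h, g • p ∈ closure (tile h) → IsPreconnected (insert (g • p) (tile h)) :=
    fun h hh => (isPreconnected_tile h).subset_closure (Set.subset_insert _ _)
      (Set.insert_subset hh subset_closure)
  -- A connected set stays connected when a limit point is added, and the two enlarged tiles meet at
  -- `g • p`.
  refine ⟨insert (g • p) (tile g) ∪ insert (g • p) (tile (g * s)), ?_, ?_, ?_, ?_⟩
  · exact Set.union_subset (Set.insert_subset hmem (hdom _ hg))
      (Set.insert_subset hmem (hdom _ hgs))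
  · exact (hpre _ (himg' p hp)).union (g • p) (Set.mem_insert _ _) (Set.mem_insert _ _)
      (hpre _ (himg p hp'))
  · exact (Set.subset_insert _ _).trans Set.subset_union_left
  · exact (Set.subset_insert _ _).trans Set.subset_union_right

theorem linked_mul_T (hg : closure (tile g) ⊆ covered θ)
    (hgs : closure (tile (g * T)) ⊆ covered θ) : Linked θ g (g * T) := by
  have key : ∀ z : ℍ, z ∈ closure (tile T) ↔ 1 ≤ (z.re - 1) ^ 2 + z.im ^ 2 ∧
      |z.re - 1| ≤ 1 / 2 := by
    intro z
    rw [mem_closure_tile, fd, Set.mem_ofPred_eq, Complex.normSq_apply]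
    simp only [coe_re, coe_im, re_T_inv_smul, im_T_inv_smul, pow_two]
  have key' : ∀ z : ℍ, z ∈ fd ↔ 1 ≤ z.re ^ 2 + z.im ^ 2 ∧ |z.re| ≤ 1 / 2 := by
    intro z
    rw [fd, Set.mem_ofPred_eq, Complex.normSq_apply]
    simp only [coe_re, coe_im, pow_two]
  -- A point on the common edge Re z = 1/2, high enough that both circle conditions hold nearby;
  -- only Re z against 1/2 matters.
  let p : ℍ := ⟨⟨1 / 2, 2⟩, two_pos⟩
  have hre : p.re = 1 / 2 := rfl
  have him : p.im = 2 := rfl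
  refine linked_mul_of_nhds (p := p) ?_ ?_ ?_ hg hgs
  · rw [key', hre, him]
    norm_num [abs_le]
  · rw [key, hre, him]
    norm_num [abs_le]
  · have h1 : ∀ᶠ z : ℍ in 𝓝 p, 0 < z.re :=
      continuous_re.continuousAt.eventually_const_lt (by rw [hre]; norm_num)
    have h2 : ∀ᶠ z : ℍ in 𝓝 p, z.re < 1 :=
      continuous_re.continuousAt.eventually_lt_const (by rw [hre]; norm_num)
    have h3 : ∀ᶠ z : ℍ in 𝓝 p, 1 < z.im :=
      continuous_im.continuousAt.eventually_const_lt (by rw [him]; norm_num)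
    filter_upwards [h1, h2, h3] with z h1 h2 h3
    rw [Set.mem_union, key, key', abs_le, abs_le]
    rcases le_total z.re (1 / 2) with h | h
    · exact Or.inl ⟨by nlinarith, by linarith, h⟩
    · exact Or.inr ⟨by nlinarith, by linarith, by linarith⟩

theorem linked_mul_S (hg : closure (tile g) ⊆ covered θ)
    (hgs : closure (tile (g * S)) ⊆ covered θ) : Linked θ g (g * S) := by
  have hnorm : ∀ z : ℍ, Complex.normSq (S • z : ℍ) = (Complex.normSq z)⁻¹ := by
    intro z
    rw [modular_S_smul, coe_mk, map_inv₀, Complex.normSq_neg]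
  have hre : ∀ z : ℍ, (S • z : ℍ).re = -z.re / Complex.normSq z := by
    intro z
    rw [modular_S_smul, mk_re, Complex.inv_re, Complex.normSq_neg, Complex.neg_re, coe_re]
  have key : ∀ z : ℍ, z ∈ closure (tile S) ↔ 1 ≤ (Complex.normSq (z : ℂ))⁻¹ ∧
      |-z.re / Complex.normSq z| ≤ 1 / 2 := by
    intro z
    rw [mem_closure_tile, S_inv, SL_neg_smul, fd, Set.mem_ofPred_eq, hnorm, hre]
  have hcont : Continuous fun z : ℍ => Complex.normSq (z : ℂ) :=
    Complex.continuous_normSq.comp continuous_coe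
  refine linked_mul_of_nhds (p := I) I_mem_fd ?_ ?_ hg hgs
  · rw [key]
    norm_num
  -- These bounds give |Re z| ≤ 1/2 and |Re(Sz)| = |Re z|/|z|² ≤ 1/2 near i, so only |z| against 1
  -- decides which tile contains z.
  · have h1 : ∀ᶠ z : ℍ in 𝓝 I, |z.re| < 1 / 4 :=
      continuous_re.abs.continuousAt.eventually_lt_const (by norm_num)
    have h2 : ∀ᶠ z : ℍ in 𝓝 I, 1 / 2 < Complex.normSq (z : ℂ) :=
      hcont.continuousAt.eventually_const_lt (by norm_num)
    filter_upwards [h1, h2] with z h1 h2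
    rw [Set.mem_union, key]
    rcases le_total 1 (Complex.normSq (z : ℂ)) with h | h
    · exact Or.inl ⟨h, by linarith⟩
    · refine Or.inr ⟨(one_le_inv₀ z.normSq_pos).2 h, ?_⟩
      rw [abs_div, abs_neg, abs_of_pos z.normSq_pos, div_le_iff₀ z.normSq_pos]
      linarith

theorem linked_mul_zpow {a b : ℤ}
    (H : ∀ i, a ≤ i → i ≤ b → closure (tile (g * T ^ i)) ⊆ covered θ) {i j : ℤ}
    (hi : a ≤ i ∧ i ≤ b) (hj : a ≤ j ∧ j ≤ b) : Linked θ (g * T ^ i) (g * T ^ j) := by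
  have up : ∀ i j : ℤ, a ≤ i → i ≤ j → j ≤ b → Linked θ (g * T ^ i) (g * T ^ j) := by
    intro i j hi hij
    induction j, hij using Int.leInduction with
    | base => exact fun h => linked_refl (H i hi h)
    | succ j hij ih =>
      intro h
      refine (ih (by omega)).trans ?_
      have h1 := H j (by omega) (by omega)
      have h2 := H (j + 1) (by omega) h
      rw [zpow_add_one, ← mul_assoc] at h2 ⊢
      exact linked_mul_T h1 h2
  rcases le_total i j with h | h
  · exact up i j hi.1 h hj.2
  · exact (up j i hj.1 h hi.2).symm

end Linked

theorem isConnected_domain {ι : Type} {θ : ι → SL(2, ℤ)} (i₀ : ι)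
    (H : ∀ i, Linked θ (θ i₀) (θ i)) : IsConnected (domain θ) := by
  obtain ⟨x, hx⟩ := tile_nonempty (θ i₀)
  refine ⟨⟨x, tile_subset_domain θ i₀ hx⟩, isPreconnected_of_forall x fun y hy => ?_⟩
  obtain ⟨i, hi⟩ := Set.mem_iUnion.1 (interior_subset hy)
  obtain ⟨C, h1, h2, h3, h4⟩ := H i
  obtain ⟨w, hw⟩ := tile_nonempty (θ i)
  refine ⟨C ∪ insert y (tile (θ i)), Set.union_subset h1 (Set.insert_subset hy
    (tile_subset_domain θ i)), Or.inl (h3 hx), Or.inr (Set.mem_insert _ _), ?_⟩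
  exact h2.union w (h4 hw) (Set.mem_insert_of_mem _ hw) ((isPreconnected_tile _).subset_closure
    (Set.subset_insert _ _) (Set.insert_subset hi subset_closure))

/-! ### From coset representatives to fundamental domains -/

theorem isRightCosetReps_iff {Γ : Subgroup SL(2, ℤ)} {ι : Type} {θ : ι → SL(2, ℤ)} :
    IsRightCosetReps Γ θ ↔ (∀ i j, θ j * (θ i)⁻¹ ∈ pm Γ → i = j) ∧
      ∀ g, ∃ i, g * (θ i)⁻¹ ∈ pm Γ := by
  refine and_congr ?_ ?_
  · refine forall₂_congr fun i j => ?_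
    change (Quotient.mk _ _ = Quotient.mk _ _ → _) ↔ _
    rw [Quotient.eq, QuotientGroup.rightRel_apply]
  · refine ⟨fun h g => ?_, fun h q => ?_⟩
    · obtain ⟨i, hi⟩ := h (Quotient.mk _ g)
      exact ⟨i, QuotientGroup.rightRel_apply.1 (Quotient.eq.1 hi)⟩
    · induction q using Quotient.inductionOn with
      | h g =>
        obtain ⟨i, hi⟩ := h g
        exact ⟨i, Quotient.eq.2 (QuotientGroup.rightRel_apply.2 hi)⟩

theorem exists_smul_eq_of_mem_pm {Γ : Subgroup SL(2, ℤ)} {g : SL(2, ℤ)} (hg : g ∈ pm Γ) :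
    ∃ γ ∈ Γ, ∀ z : ℍ, γ • z = g • z := by
  rcases hg with h | h
  · exact ⟨g, h, fun _ => rfl⟩
  · exact ⟨-g, h, fun z => SL_neg_smul g z⟩

theorem IsFundamentalList.isFundamentalDomain {Γ : Subgroup SL(2, ℤ)} {ι : Type}
    {θ : ι → SL(2, ℤ)} (H : IsFundamentalList Γ θ) : IsFundamentalDomain Γ (domain θ) := by
  obtain ⟨hinj, hsurj⟩ := isRightCosetReps_iff.1 H.reps
  refine ⟨isOpen_interior, H.connected, ?_, ?_⟩
  · rintro x hx y hy ⟨γ, hγ, rfl⟩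
    have hopen : IsOpen (domain θ ∩ (fun z : ℍ => γ • z) ⁻¹' domain θ) :=
      isOpen_interior.inter (isOpen_interior.preimage (continuous_smul_sl γ))
    obtain ⟨i, hi⟩ := Set.mem_iUnion.1 (interior_subset hx)
    -- Both x and γx may lie on tile boundaries, so x is moved to a nearby z in an open tile with γz
    -- still in the domain.
    obtain ⟨z, ⟨-, hz⟩, hzi⟩ := mem_closure_iff.1 hi _ hopen ⟨hx, hy⟩
    obtain ⟨j, hj⟩ := Set.mem_iUnion.1 (interior_subset hz)
    replace hzi := mem_tile.1 hzi
    replace hj := mem_closure_tile.1 hj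
    have hmul : ((θ j)⁻¹ * γ * θ i) • (θ i)⁻¹ • z ∈ fd := by
      simpa [mul_smul] using hj
    have hcases := eq_one_or_neg_one_of_mem_fdo_mem_fd hzi hmul
    have hγ' : γ = θ j * (θ i)⁻¹ ∨ γ = -(θ j * (θ i)⁻¹) := by
      have hform : γ = θ j * ((θ j)⁻¹ * γ * θ i) * (θ i)⁻¹ := by group
      rcases hcases with h | h
      · left; rw [hform, h]; simp
      · right; rw [hform, h]; simp
    have hpm : θ j * (θ i)⁻¹ ∈ pm Γ := by
      rcases hγ' with h | h
      · exact Or.inl (h ▸ hγ)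
      · exact Or.inr (h ▸ hγ)
    obtain rfl := hinj i j hpm
    rcases hγ' with h | h <;> rw [h] <;> simp
  · intro x
    obtain ⟨g, hg⟩ := exists_smul_mem_fd x
    -- With g⁻¹ in the coset of θᵢ, the product θᵢg acts as some γ in Γ, and γx = θᵢ(gx) lies in the
    -- closed tile of θᵢ.
    obtain ⟨i, hi⟩ := hsurj g⁻¹
    obtain ⟨γ, hγ, hsmul⟩ := exists_smul_eq_of_mem_pm ((pm Γ).inv_mem hi)
    refine ⟨γ • x, closure_mono (tile_subset_domain θ i) ?_, γ, hγ, rfl⟩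
    rw [mem_closure_tile, hsmul]
    simpa [mul_smul] using hg

/-! ### Bottom rows modulo `N` -/

/-- The bottom row of a matrix, modulo `N`. -/
def row (N : ℕ) (g : SL(2, ℤ)) : ZMod N × ZMod N := ((g 1 0 : ℤ), (g 1 1 : ℤ))

section Row

variable (N : ℕ) (g h : SL(2, ℤ))

theorem row_mul : row N (g * h) = ((g 1 0 : ZMod N) * (h 0 0 : ℤ) + (g 1 1 : ℤ) * (h 1 0 : ℤ),
    (g 1 0 : ZMod N) * (h 0 1 : ℤ) + (g 1 1 : ℤ) * (h 1 1 : ℤ)) := by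
  simp [row, Matrix.mul_apply, Fin.sum_univ_two]

theorem row_neg : row N (-g) = -row N g := by
  simp [row]

theorem row_S : row N S = (1, 0) := by
  simp [row, coe_S]

theorem row_mul_S : row N (g * S) = ((row N g).2, -(row N g).1) := by
  rw [row_mul]
  simp [row, coe_S]

theorem row_mul_T_zpow (n : ℤ) :
    row N (g * T ^ n) = ((row N g).1, (row N g).2 + n * (row N g).1) := by
  rw [row_mul]
  have h := coe_T_zpow n
  simp [row, h, mul_comm, add_comm]

theorem row_mul_T_pow (n : ℕ) :
    row N (g * T ^ n) = ((row N g).1, (row N g).2 + n * (row N g).1) := by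
  simpa using row_mul_T_zpow N g n

theorem det_cast : (g 0 0 : ZMod N) * (g 1 1 : ℤ) - (g 0 1 : ℤ) * (g 1 0 : ℤ) = 1 := by
  have h := g.det_coe
  rw [Matrix.det_fin_two] at h
  exact_mod_cast congrArg (Int.cast : ℤ → ZMod N) h

theorem mul_inv_one_zero : (((g * h⁻¹ : SL(2, ℤ)) 1 0 : ℤ) : ZMod N) =
    (row N g).1 * (row N h).2 - (row N g).2 * (row N h).1 := by
  refine (congrArg Prod.fst (row_mul N g h⁻¹)).trans ?_
  simp [Matrix.SpecialLinearGroup.SL2_inv_expl, row, sub_eq_add_neg]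

theorem mul_inv_one_one : (((g * h⁻¹ : SL(2, ℤ)) 1 1 : ℤ) : ZMod N) =
    (row N g).2 * (h 0 0 : ℤ) - (row N g).1 * (h 0 1 : ℤ) := by
  refine (congrArg Prod.snd (row_mul N g h⁻¹)).trans ?_
  simp [Matrix.SpecialLinearGroup.SL2_inv_expl, row]
  ring

variable {N g h}

theorem mul_inv_mem_Gamma1_iff :
    g * h⁻¹ ∈ CongruenceSubgroup.Gamma1 N ↔ row N g = row N h := by
  rw [CongruenceSubgroup.Gamma1_mem]
  constructor
  · rintro ⟨-, h1, h2⟩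
    have e : g = g * h⁻¹ * h := by group
    rw [e, row_mul, h1, h2]
    simp [row]
  · intro e
    have h2 := mul_inv_one_zero N g h
    have h1 := mul_inv_one_one N g h
    have hd := det_cast N h
    have hd' := det_cast N (g * h⁻¹)
    rw [e] at h1 h2
    replace h2 : (((g * h⁻¹ : SL(2, ℤ)) 1 0 : ℤ) : ZMod N) = 0 := by rw [h2]; ring
    replace h1 : (((g * h⁻¹ : SL(2, ℤ)) 1 1 : ℤ) : ZMod N) = 1 := by
      -- When the rows agree, the lower right entry of gh⁻¹ is det h; the upper left one is then
      -- forced by det(gh⁻¹) = 1.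
      rw [h1, ← hd]
      simp only [row]
      ring
    rw [h1, h2] at hd'
    exact ⟨by simpa using hd', h1, h2⟩

theorem mul_inv_mem_pm_Gamma1_iff :
    g * h⁻¹ ∈ pm (CongruenceSubgroup.Gamma1 N) ↔ row N g = row N h ∨ row N g = -row N h := by
  change _ ∨ -(g * h⁻¹) ∈ _ ↔ _
  rw [← neg_mul, mul_inv_mem_Gamma1_iff, mul_inv_mem_Gamma1_iff, row_neg, neg_eq_iff_eq_neg]

theorem mem_pm_Gamma0_iff : g ∈ pm (CongruenceSubgroup.Gamma0 N) ↔ (g 1 0 : ZMod N) = 0 := by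
  change _ ∨ _ ↔ _
  simp [CongruenceSubgroup.Gamma0_mem]

/-- If gh⁻¹ has bottom row (0, d), its determinant makes d a unit, and d is the factor. Conversely
the lower left entry of gh⁻¹ is the 2×2 determinant of the two rows. -/
theorem mul_inv_mem_pm_Gamma0_iff : g * h⁻¹ ∈ pm (CongruenceSubgroup.Gamma0 N) ↔
    ∃ u : (ZMod N)ˣ, row N g = (u : ZMod N) • row N h := by
  rw [mem_pm_Gamma0_iff]
  constructor
  · intro h0
    have hd := det_cast N (g * h⁻¹)
    rw [h0, mul_zero, sub_zero, mul_comm] at hd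
    refine ⟨Units.mkOfMulEqOne _ _ hd, ?_⟩
    have e : g = g * h⁻¹ * h := by group
    conv_lhs => rw [e, row_mul, h0]
    simp [row]
  · rintro ⟨u, hu⟩
    rw [mul_inv_one_zero, hu]
    simp only [Prod.smul_fst, Prod.smul_snd, smul_eq_mul]
    ring

end Row

/-! ### Indices and residues -/

section Indices

variable {N : ℕ} [NeZero N]

theorem N1_nonneg : 0 ≤ N1 N := by
  have := NeZero.pos N
  unfold N1
  omega

theorem zero_mem_range : -N1 N ≤ 0 ∧ 0 ≤ N2 N := by
  have := N1_nonneg (N := N)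
  unfold N2
  omega

theorem tilde_mem_range (x : ℤ) : -N1 N ≤ tilde N x ∧ tilde N x ≤ N2 N :=
  ((tilde_eq_iff (NeZero.pos N) x _).1 rfl).2

theorem tilde_cast (x : ℤ) : (tilde N x : ZMod N) = x :=
  (ZMod.intCast_eq_intCast_iff _ _ _).2 ((tilde_eq_iff (NeZero.pos N) x _).1 rfl).1

theorem eq_of_cast_eq {i j : ℤ} (hi : -N1 N ≤ i ∧ i ≤ N2 N) (hj : -N1 N ≤ j ∧ j ≤ N2 N)
    (h : (i : ZMod N) = j) : i = j := by
  rw [ZMod.intCast_eq_intCast_iff] at h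
  rw [← (tilde_eq_iff (NeZero.pos N) j i).2 ⟨h, hi⟩, (tilde_eq_iff (NeZero.pos N) j j).2 ⟨rfl, hj⟩]

theorem exists_mem_range (a : ZMod N) : ∃ i : ℤ, (-N1 N ≤ i ∧ i ≤ N2 N) ∧ (i : ZMod N) = a :=
  ⟨tilde N a.val, tilde_mem_range _, by rw [tilde_cast]; simp⟩

omit [NeZero N] in
theorem int_gcd_eq_one_iff (j : ℤ) : Int.gcd j N = 1 ↔ IsUnit (j : ZMod N) := by
  rw [ZMod.coe_int_isUnit_iff_isCoprime, isCoprime_comm, Int.isCoprime_iff_gcd_eq_one]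

theorem one_lt_int_gcd_iff (j : ℤ) : 1 < Int.gcd j N ↔ ¬ IsUnit (j : ZMod N) := by
  have : 0 < Int.gcd j N := Int.gcd_pos_of_ne_zero_right _ (by exact_mod_cast NeZero.ne N)
  rw [← int_gcd_eq_one_iff]
  omega

theorem one_lt_gcdN_iff (a : ZMod N) : 1 < gcdN N a ↔ ¬ IsUnit a := by
  have : 0 < gcdN N a := Nat.gcd_pos_of_pos_right _ (NeZero.pos N)
  rw [← gcdN_eq_one_iff]
  omega

theorem kinv_cast (k : ℤ) : (kinv N k : ZMod N) = (k : ZMod N)⁻¹ := by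
  simp [kinv]

/-! ### Representatives for Γ₀(N) -/

/-- The bottom rows, up to sign, of the list `theta0`. -/
def baseRow (N : ℕ) [NeZero N] : ResIdx N ⊕ InfIdx N → ZMod N × ZMod N
  | .inl i => (1, (i.1 : ℤ))
  | .inr q => ((q.1.1 : ℤ), (q.1.2 : ℕ) * (q.1.1 : ℤ) - 1)

theorem row_theta0 (x : ResIdx N ⊕ InfIdx N) : row N (theta0 N x) = baseRow N x := by
  rcases x with i | q
  · simp [theta0, baseRow, row_mul_T_zpow, row_S]
  · simp [theta0, baseRow, row_mul_T_pow, row_mul_T_zpow, row_S, row_mul_S]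
    ring

theorem row_gcd (g : SL(2, ℤ)) : Nat.gcd (Nat.gcd (row N g).1.val (row N g).2.val) N = 1 := by
  set d := Nat.gcd (Nat.gcd (row N g).1.val (row N g).2.val) N
  have hdN : d ∣ N := Nat.gcd_dvd_right _ _
  have hd := Nat.gcd_dvd_left (Nat.gcd (row N g).1.val (row N g).2.val) N
  have hzero : ∀ c : ZMod N, d ∣ c.val → ZMod.castHom hdN (ZMod d) c = 0 := by
    intro c hc
    rw [← ZMod.natCast_zmod_val c, map_natCast]
    exact (ZMod.natCast_eq_zero_iff _ _).2 hc
  have h1 := hzero _ (hd.trans (Nat.gcd_dvd_left _ _))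
  have h2 := hzero _ (hd.trans (Nat.gcd_dvd_right _ _))
  have hdet := congrArg (ZMod.castHom hdN (ZMod d)) (det_cast N g)
  change ZMod.castHom hdN (ZMod d) ((g 1 0 : ℤ) : ZMod N) = 0 at h1
  change ZMod.castHom hdN (ZMod d) ((g 1 1 : ℤ) : ZMod N) = 0 at h2
  rw [map_sub, map_mul, map_mul, h1, h2, mul_zero, mul_zero, sub_zero, map_one] at hdet
  have : ((1 : ℕ) : ZMod d) = 0 := by simpa using hdet.symm
  rw [ZMod.natCast_eq_zero_iff] at this
  exact Nat.dvd_one.1 this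

theorem isUnit_Mpair (p : Pair N) : IsUnit ((Mpair p : ZMod N) * p.1.1 - p.1.2) :=
  (gcdN_eq_one_iff _).1 (Nat.sInf_mem (exists_unit p))

omit [NeZero N] in
theorem mul_inv_unit_cancel {c : ZMod N} (hc : IsUnit c) (a : ZMod N) : c * (a * c⁻¹) = a := by
  rw [mul_left_comm, ZMod.mul_inv_of_unit c hc, mul_one]

/-- `1 - t j` is not a unit for `0 < t ≤ M_j`. -/
theorem not_isUnit_of_le_Mj {j : ZMod N} (hj : ¬ IsUnit j) {t : ℕ} (ht : 0 < t)
    (htM : t ≤ Mj N j) : ¬ IsUnit (1 - t * j) := by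
  -- Take a class (a:b) attaining M_j. Then (M_j - t)a - b = c(1 - tj), which is not a unit by
  -- minimality of M(a:b).
  obtain ⟨P, ⟨⟨p, rfl, hp⟩, hpr⟩, hM⟩ := (Mj_isGreatest j ((one_lt_gcdN_iff j).2 hj)).1
  change Mpair p = _ at hM
  change (prPair p).1 = j at hpr
  rw [prPair, if_neg hp.ne'] at hpr
  simp only at hpr
  have hc := isUnit_Mpair p
  set c := (Mpair p : ZMod N) * p.1.1 - p.1.2 with hcdef
  have hpj : p.1.1 = c * j := by rw [← hpr, mul_inv_unit_cancel hc]
  have hlt : Mpair p - t < Mpair p := by omega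
  have hn := Nat.notMem_of_lt_sInf (show Mpair p - t < sInf _ from hlt)
  rw [Set.mem_ofPred_eq, gcdN_eq_one_iff, Nat.cast_sub (by omega)] at hn
  intro hu
  apply hn
  have e : ((Mpair p : ZMod N) - t) * p.1.1 - p.1.2 = c * (1 - t * j) := by
    rw [mul_sub, mul_one, mul_left_comm c, ← hpj, hcdef]
    ring
  rw [e]
  exact hc.mul hu

theorem exists_eq_smul_baseRow (g : SL(2, ℤ)) :
    ∃ (x : ResIdx N ⊕ InfIdx N) (u : (ZMod N)ˣ), row N g = (u : ZMod N) • baseRow N x := by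
  by_cases hc : IsUnit (row N g).1
  · obtain ⟨u, hu⟩ := hc
    obtain ⟨i, hi, hia⟩ := exists_mem_range (((u⁻¹ : (ZMod N)ˣ) : ZMod N) * (row N g).2)
    refine ⟨.inl ⟨i, hi⟩, u, Prod.ext ?_ ?_⟩
    · simp [baseRow, hu]
    · simp [baseRow, hia]
  · let p : Pair N := ⟨row N g, row_gcd g⟩
    have hp : 1 < gcdN N p.1.1 := (one_lt_gcdN_iff _).2 hc
    obtain ⟨u, hu⟩ := isUnit_Mpair p
    obtain ⟨j, hj, hja⟩ := exists_mem_range (p.1.1 * (u : ZMod N)⁻¹)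
    have huj : (u : ZMod N) * j = p.1.1 := by rw [hja, mul_inv_unit_cancel u.isUnit]
    have hju : ¬ IsUnit (j : ZMod N) := fun h => hc (by simpa [huj] using u.isUnit.mul h)
    have hM : Mpair p ≤ Mj N (j : ZMod N) := by
      refine (Mj_isGreatest (j : ZMod N) ((one_lt_gcdN_iff _).2 hju)).2
        ⟨P1.mk p, ⟨⟨p, rfl, hp⟩, ?_⟩, rfl⟩
      change (prPair p).1 = _
      rw [prPair, if_neg hp.ne', hja, hu]
    refine ⟨.inr ⟨(j, Mpair p), hj, (one_lt_int_gcd_iff j).2 hju, hM⟩, u, Prod.ext ?_ ?_⟩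
    · exact huj.symm
    · change p.1.2 = (u : ZMod N) * ((Mpair p : ℕ) * (j : ℤ) - 1)
      rw [mul_sub, mul_left_comm, huj, hu]
      ring

/-- Between two rows at infinity, comparing coordinates makes 1 - tj or 1 - tj' a unit, where t is
the difference of the exponents m and m'. Since t ≤ M_j or t ≤ M_j', this forces t = 0, and then u =
1. -/
theorem smul_baseRow_injective {x y : ResIdx N ⊕ InfIdx N} {u : (ZMod N)ˣ}
    (h : baseRow N x = (u : ZMod N) • baseRow N y) : x = y ∧ u = 1 := by
  have hnu : ∀ q : InfIdx N, ¬ IsUnit ((q.1.1 : ℤ) : ZMod N) := fun q =>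
    (one_lt_int_gcd_iff _).1 q.2.2.1
  have h1 := congrArg Prod.fst h
  have h2 := congrArg Prod.snd h
  rcases x with i | q <;> rcases y with i' | q' <;>
    simp only [baseRow, Prod.smul_mk, smul_eq_mul, mul_one] at h1 h2
  · have hu : u = 1 := Units.ext h1.symm
    rw [hu, Units.val_one, one_mul] at h2
    exact ⟨congrArg Sum.inl (Subtype.ext (eq_of_cast_eq i.2 i'.2 h2)), hu⟩
  · exact absurd (isUnit_of_mul_isUnit_right (h1 ▸ isUnit_one)) (hnu q')
  · exact absurd (h1 ▸ u.isUnit) (hnu q)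
  · have hm : q.1.2 = q'.1.2 := by
      rcases lt_trichotomy q.1.2 q'.1.2 with hlt | heq | hlt
      · refine absurd ?_ (not_isUnit_of_le_Mj (hnu q') (Nat.sub_pos_of_lt hlt)
          ((Nat.sub_le _ _).trans q'.2.2.2))
        refine IsUnit.of_mul_eq_one (u : ZMod N) ?_
        rw [h1] at h2
        rw [Nat.cast_sub hlt.le]
        linear_combination h2
      · exact heq
      · refine absurd ?_ (not_isUnit_of_le_Mj (hnu q) (Nat.sub_pos_of_lt hlt)
          ((Nat.sub_le _ _).trans q.2.2.2))
        have e : (1 - ((q.1.2 - q'.1.2 : ℕ) : ZMod N) * (q.1.1 : ℤ)) = u := by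
          rw [Nat.cast_sub hlt.le]
          linear_combination -h2 + (q'.1.2 : ZMod N) * h1
        rw [e]
        exact Units.isUnit _
    have hu : u = 1 := by
      refine Units.ext ?_
      rw [hm] at h2
      rw [Units.val_one]
      linear_combination h2 - (q'.1.2 : ZMod N) * h1
    rw [hu, Units.val_one, one_mul] at h1
    exact ⟨congrArg Sum.inr (Subtype.ext (Prod.ext (eq_of_cast_eq q.2.1 q'.2.1 h1) hm)), hu⟩

theorem isRightCosetReps_theta0 : IsRightCosetReps (CongruenceSubgroup.Gamma0 N) (theta0 N) := by
  refine isRightCosetReps_iff.2 ⟨fun x y h => ?_, fun g => ?_⟩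
  · obtain ⟨u, hu⟩ := mul_inv_mem_pm_Gamma0_iff.1 h
    rw [row_theta0, row_theta0] at hu
    exact (smul_baseRow_injective hu).1.symm
  · obtain ⟨x, u, hu⟩ := exists_eq_smul_baseRow (N := N) g
    exact ⟨x, mul_inv_mem_pm_Gamma0_iff.2 ⟨u, by rw [row_theta0, hu]⟩⟩

end Indices

section Lists

variable {N : ℕ} [NeZero N]

/-! ### The list for `Γ₁(N)` -/

omit [NeZero N] in
theorem isUnit_unitIdx (k : UnitIdx N) : IsUnit (k.1 : ZMod N) :=
  (int_gcd_eq_one_iff _).1 k.2.2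

/-- The indices of the list `theta1`. -/
abbrev Idx1 (N : ℕ) [NeZero N] : Type :=
  (ResIdx N ⊕ InfIdx N) ⊕ (UnitIdx N × ResIdx N ⊕ UnitIdx N × InfIdx N)

/-- The unit, up to sign, which relates the bottom row of an element of `theta1` to the bottom row
of an element of `theta0`. -/
def scale : Idx1 N → ℤ
  | .inl _ => -1
  | .inr (.inl (k, _)) => k.1
  | .inr (.inr (k, _)) => k.1

/-- The element of `theta0` which represents the same point of the projective line as a given
element of `theta1`. -/
def base : Idx1 N → ResIdx N ⊕ InfIdx N
  | .inl x => x
  | .inr (.inl (k, i)) => .inl ⟨tilde N (i.1 - kinv N k.1), tilde_mem_range _⟩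
  | .inr (.inr (_, q)) => .inr q

/-- The row of ST^kST^i is (k, ik - 1) = k(1, i - k⁻¹). The exponent k⁻¹ + j is chosen so that
appending S gives k(j, -1), and T^m then gives k(j, mj - 1). -/
theorem row_theta1 (y : Idx1 N) : row N (theta1 N y) = (scale y : ZMod N) • baseRow N (base y) ∨
    row N (theta1 N y) = -((scale y : ZMod N) • baseRow N (base y)) := by
  rcases y with x | ⟨k, i⟩ | ⟨k, q⟩
  · right
    simp [theta1, row_theta0, scale, base]
  · left
    have hk := ZMod.mul_inv_of_unit _ (isUnit_unitIdx k)
    simp only [theta1, scale, base, baseRow, row_mul_T_zpow, row_S, row_mul_S, tilde_cast,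
      Int.cast_sub, kinv_cast, Prod.smul_mk, smul_eq_mul]
    refine Prod.ext ?_ ?_
    · simp
    · linear_combination hk
  · left
    have hk := ZMod.mul_inv_of_unit _ (isUnit_unitIdx k)
    simp only [theta1, scale, base, baseRow, row_mul_T_zpow, row_mul_T_pow, row_S, row_mul_S,
      tilde_cast, Int.cast_add, kinv_cast, Prod.smul_mk, smul_eq_mul]
    refine Prod.ext ?_ ?_
    · linear_combination hk
    · linear_combination (q.1.2 : ZMod N) * hk

theorem isUnit_scale (y : Idx1 N) : IsUnit (scale y : ZMod N) := by
  rcases y with x | ⟨k, i⟩ | ⟨k, q⟩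
  · simp [scale]
  · exact isUnit_unitIdx k
  · exact isUnit_unitIdx k

theorem scale_bounds (y : Idx1 N) : scale y = -1 ∨ -N1 N ≤ scale y ∧ scale y ≤ -2 := by
  rcases y with x | ⟨k, i⟩ | ⟨k, q⟩
  · exact Or.inl rfl
  · exact Or.inr k.2.1
  · exact Or.inr k.2.1

theorem eq_of_scale_of_base {y z : Idx1 N} (h : scale y = scale z) (h' : base y = base z) :
    y = z := by
  have hlt : ∀ k : UnitIdx N, k.1 ≠ -1 := fun k => by have := k.2.1.2; omega
  rcases y with x | ⟨k, i⟩ | ⟨k, q⟩ <;> rcases z with x' | ⟨k', i'⟩ | ⟨k', q'⟩ <;>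
    simp only [scale, base, reduceCtorEq, Sum.inr.injEq] at h h'
  · rw [h']
  · exact absurd h.symm (hlt k')
  · exact absurd h.symm (hlt k')
  · exact absurd h (hlt k)
  · obtain rfl : k = k' := Subtype.ext h
    have ht := congrArg (fun i : ResIdx N => (i.1 : ZMod N)) (Sum.inl.inj h')
    simp only [tilde_cast, Int.cast_sub, sub_left_inj] at ht
    rw [show i = i' from Subtype.ext (eq_of_cast_eq i.2 i'.2 ht)]
  · exact absurd h (hlt k)
  · rw [h', show k = k' from Subtype.ext h]

/-- Unless both scales are -1, their sum lies strictly between -N and 0, so they cannot be opposite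
modulo `N`. The excluded case is genuine: 1 = -1 when `N` is 2. -/
theorem scale_eq_of_cast_eq (y z : Idx1 N)
    (h : (scale y : ZMod N) = scale z ∨ (scale y : ZMod N) = -scale z) : scale y = scale z := by
  have hN := NeZero.pos N
  have hb : 2 * N1 N ≤ N - 1 := by unfold N1; omega
  rcases scale_bounds y with hy | hy <;> rcases scale_bounds z with hz | hz
  · rw [hy, hz]
  all_goals
    rcases h with h | h
    · exact eq_of_cast_eq ⟨by omega, by unfold N2; omega⟩ ⟨by omega, by unfold N2; omega⟩ h
    · rw [eq_neg_iff_add_eq_zero, ← Int.cast_add, ZMod.intCast_zmod_eq_zero_iff_dvd,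
        ← dvd_neg] at h
      have := Int.le_of_dvd (by omega) h
      omega

theorem exists_scale_base (hN : 1 < N) (u : (ZMod N)ˣ) (x : ResIdx N ⊕ InfIdx N) :
    ∃ y : Idx1 N, ((scale y : ZMod N) = u ∨ (scale y : ZMod N) = -u) ∧ base y = x := by
  have : Fact (1 < N) := ⟨hN⟩
  have key : ∀ k : UnitIdx N, ∃ y : Idx1 N, scale y = k.1 ∧ base y = x := by
    intro k
    rcases x with i | q
    · refine ⟨.inr (.inl (k, ⟨tilde N (i.1 + kinv N k.1), tilde_mem_range _⟩)), rfl,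
        congrArg Sum.inl (Subtype.ext (eq_of_cast_eq (tilde_mem_range _) i.2 ?_))⟩
      simp [tilde_cast]
    · exact ⟨.inr (.inr (k, q)), rfl, rfl⟩
  obtain ⟨i, hi, hiu⟩ := exists_mem_range (u : ZMod N)
  have hgcd : Int.gcd i N = 1 := (int_gcd_eq_one_iff i).2 (hiu ▸ u.isUnit)
  rcases le_or_gt i (-2) with h | h
  · obtain ⟨y, hy, hyx⟩ := key ⟨i, ⟨hi.1, h⟩, hgcd⟩
    exact ⟨y, Or.inl (by rw [hy, hiu]), hyx⟩
  rcases le_or_gt 2 i with h' | h'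
  -- The range is asymmetric: -i falls outside it only if N = 2i, and then i ≥ 2 is not prime to
  -- `N`.
  · have hi1 : i ≤ N1 N := by
      by_contra hlt
      have h2 := hi.2
      have hNi : (N : ℤ) = 2 * i := by
        unfold N1 at hlt
        unfold N2 at h2
        omega
      rw [hNi, Int.gcd_mul_left_right] at hgcd
      omega
    obtain ⟨y, hy, hyx⟩ := key ⟨-i, ⟨by omega, by omega⟩, by rwa [Int.neg_gcd]⟩
    exact ⟨y, Or.inr (by rw [hy, Int.cast_neg, hiu]), hyx⟩
  · have hcases : i = -1 ∨ i = 0 ∨ i = 1 := by omega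
    refine ⟨.inl x, ?_, rfl⟩
    rcases hcases with rfl | rfl | rfl
    · exact Or.inl hiu
    · rw [Int.cast_zero] at hiu
      exact absurd hiu.symm u.ne_zero
    · exact Or.inr (by rw [← hiu]; simp [scale])

theorem isRightCosetReps_theta1 (hN : 1 < N) :
    IsRightCosetReps (CongruenceSubgroup.Gamma1 N) (theta1 N) := by
  refine isRightCosetReps_iff.2 ⟨fun y z h => ?_, fun g => ?_⟩
  · rw [mul_inv_mem_pm_Gamma1_iff] at h
    obtain ⟨v, hv⟩ := isUnit_scale z
    obtain ⟨w, hw⟩ := isUnit_scale y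
    have hrow : (v : ZMod N) • baseRow N (base z) = (w : ZMod N) • baseRow N (base y) ∨
        (v : ZMod N) • baseRow N (base z) = ((-w : (ZMod N)ˣ) : ZMod N) • baseRow N (base y) := by
      rw [Units.val_neg, _root_.neg_smul, hv, hw]
      rcases row_theta1 y with hy | hy <;> rcases row_theta1 z with hz | hz <;>
        rcases h with h | h <;> rw [hy, hz] at h <;> simp_all [neg_eq_iff_eq_neg]
    -- Units act freely on the rows, so equal multiples have equal base rows and equal factors.
    have solve : ∀ w' : (ZMod N)ˣ,
        (v : ZMod N) • baseRow N (base z) = (w' : ZMod N) • baseRow N (base y) →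
        base z = base y ∧ v = w' := by
      intro w' e
      have e' : baseRow N (base z) = ((v⁻¹ * w' : (ZMod N)ˣ) : ZMod N) • baseRow N (base y) := by
        rw [Units.val_mul, mul_smul, ← e, smul_smul, Units.inv_mul, one_smul]
      obtain ⟨h1, h2⟩ := smul_baseRow_injective e'
      exact ⟨h1, inv_mul_eq_one.1 h2⟩
    rcases hrow with e | e
    · obtain ⟨h1, h2⟩ := solve _ e
      exact eq_of_scale_of_base (scale_eq_of_cast_eq y z (Or.inl (by rw [← hv, ← hw, h2]))) h1.symm
    · obtain ⟨h1, h2⟩ := solve _ e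
      exact eq_of_scale_of_base
        (scale_eq_of_cast_eq y z (Or.inr (by rw [← hv, ← hw, h2]; simp))) h1.symm
  · obtain ⟨x, u, hu⟩ := exists_eq_smul_baseRow (N := N) g
    obtain ⟨y, hy, rfl⟩ := exists_scale_base hN u x
    refine ⟨y, mul_inv_mem_pm_Gamma1_iff.2 ?_⟩
    rcases row_theta1 y with h | h <;> rcases hy with hy | hy <;> rw [h, hy, hu] <;> simp

/-! ### The list for `Γ(N)` -/

omit [NeZero N] in
theorem T_zpow_mem_Gamma1 (n : ℤ) : T ^ n ∈ CongruenceSubgroup.Gamma1 N := by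
  have h := coe_T_zpow n
  rw [CongruenceSubgroup.Gamma1_mem]
  simp [h]

omit [NeZero N] in
theorem mem_pm_Gamma1_of_mem_pm_Gamma {g : SL(2, ℤ)} (h : g ∈ pm (CongruenceSubgroup.Gamma N)) :
    g ∈ pm (CongruenceSubgroup.Gamma1 N) := by
  have key : ∀ a ∈ CongruenceSubgroup.Gamma N, a ∈ CongruenceSubgroup.Gamma1 N := by
    intro a ha
    rw [CongruenceSubgroup.Gamma_mem] at ha
    exact (CongruenceSubgroup.Gamma1_mem N a).2 ⟨ha.1, ha.2.2.2, ha.2.2.1⟩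
  exact h.imp (key _) (key _)

omit [NeZero N] in
theorem T_zpow_cast_eq_zero {n : ℤ} (h : T ^ n ∈ pm (CongruenceSubgroup.Gamma N)) :
    (n : ZMod N) = 0 := by
  have hT := coe_T_zpow n
  rcases h with h | h
  · simpa [hT] using (CongruenceSubgroup.Gamma_mem.1 h).2.1
  · simpa [hT] using (CongruenceSubgroup.Gamma_mem.1 h).2.1

/-- Modulo `N` such a g is upper unipotent, so it is T^ℓ with ℓ congruent to its upper right entry.
-/
theorem exists_mul_T_zpow_mem_Gamma {g : SL(2, ℤ)} (h : g ∈ CongruenceSubgroup.Gamma1 N) :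
    ∃ l : ResIdx N, g * (T ^ l.1)⁻¹ ∈ CongruenceSubgroup.Gamma N := by
  obtain ⟨h00, h11, h10⟩ := (CongruenceSubgroup.Gamma1_mem N g).1 h
  obtain ⟨l, hl, hlg⟩ := exists_mem_range ((g 0 1 : ℤ) : ZMod N)
  refine ⟨⟨l, hl⟩, ?_⟩
  have hT := coe_T_zpow l
  rw [CongruenceSubgroup.Gamma_mem]
  simp [Matrix.mul_apply, Fin.sum_univ_two, hT, Matrix.adjugate_fin_two, h00, h11, h10, hlg]

/-- Products of the powers of `T` with representatives for `Γ₁(N)` are representatives for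
`Γ(N)`. -/
theorem IsRightCosetReps.T_zpow_mul {ι : Type} {θ : ι → SL(2, ℤ)}
    (H : IsRightCosetReps (CongruenceSubgroup.Gamma1 N) θ) :
    IsRightCosetReps (CongruenceSubgroup.Gamma N)
      (fun x : ResIdx N × ι => T ^ x.1.1 * θ x.2) := by
  obtain ⟨hinj, hsurj⟩ := isRightCosetReps_iff.1 H
  refine isRightCosetReps_iff.2 ⟨?_, fun g => ?_⟩
  · rintro ⟨l, i⟩ ⟨l', j⟩ h
    have hT : ∀ n : ℤ, T ^ n ∈ pm (CongruenceSubgroup.Gamma1 N) :=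
      fun n => Or.inl (T_zpow_mem_Gamma1 n)
    obtain rfl : i = j := by
      refine hinj i j ?_
      have h1 := (pm _).mul_mem ((pm _).mul_mem (hT (-l'.1)) (mem_pm_Gamma1_of_mem_pm_Gamma h))
        (hT l.1)
      convert! h1 using 1
      group
    have h2 : T ^ (l'.1 - l.1) ∈ pm (CongruenceSubgroup.Gamma N) := by
      convert! h using 1
      group
    have h3 := T_zpow_cast_eq_zero h2
    rw [Int.cast_sub, sub_eq_zero] at h3
    rw [show l = l' from Subtype.ext (eq_of_cast_eq l.2 l'.2 h3.symm)]
  · obtain ⟨i, hi⟩ := hsurj g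
    rcases hi with hi | hi
    · obtain ⟨l, hl⟩ := exists_mul_T_zpow_mem_Gamma hi
      refine ⟨(l, i), Or.inl ?_⟩
      simpa [mul_assoc] using hl
    · obtain ⟨l, hl⟩ := exists_mul_T_zpow_mem_Gamma hi
      refine ⟨(l, i), Or.inr ?_⟩
      simpa [mul_assoc] using hl

/-! ### Connectedness -/

/-- The path S, ST^j, ST^jS, ST^jST^m stays in the list, as 0 is an allowed value of both i and m.
The left factor `p` serves the translates by T^ℓ. -/
theorem linked_theta0 {ι : Type} {θ : ι → SL(2, ℤ)} {p : SL(2, ℤ)}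
    (H : ∀ x, closure (tile (p * theta0 N x)) ⊆ covered θ) (x : ResIdx N ⊕ InfIdx N) :
    Linked θ (p * S) (p * theta0 N x) := by
  have hres : ∀ i : ℤ, -N1 N ≤ i → i ≤ N2 N → closure (tile (p * S * T ^ i)) ⊆ covered θ := by
    intro i h1 h2
    simpa [theta0, mul_assoc] using H (.inl ⟨i, h1, h2⟩)
  have hfirst : ∀ i : ℤ, -N1 N ≤ i ∧ i ≤ N2 N → Linked θ (p * S) (p * S * T ^ i) := by
    intro i hi
    simpa using linked_mul_zpow hres zero_mem_range hi
  rcases x with i | ⟨⟨j, m⟩, hj, hg, hm⟩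
  · simpa [theta0, mul_assoc] using hfirst i.1 i.2
  · simp only at hj hg hm
    have hinf : ∀ m' : ℤ, 0 ≤ m' → m' ≤ m →
        closure (tile (p * S * T ^ j * S * T ^ m')) ⊆ covered θ := by
      intro m' h1 h2
      lift m' to ℕ using h1
      have hm' : m' ≤ Mj N (j : ZMod N) := by omega
      simpa [theta0, mul_assoc] using H (.inr ⟨(j, m'), hj, hg, hm'⟩)
    have h0 := hinf 0 le_rfl (by omega)
    rw [zpow_zero, mul_one] at h0
    have h1 := (hfirst j hj).trans (linked_mul_S (hres j hj.1 hj.2) h0)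
    have h2 := linked_mul_zpow hinf (i := 0) (j := m) (by omega) (by omega)
    rw [zpow_zero, mul_one] at h2
    simpa [theta0, mul_assoc] using h1.trans h2

theorem linked_theta1 {ι : Type} {θ : ι → SL(2, ℤ)} {p : SL(2, ℤ)}
    (H : ∀ y, closure (tile (p * theta1 N y)) ⊆ covered θ) (y : Idx1 N) :
    Linked θ (p * S) (p * theta1 N y) := by
  have hbase : ∀ x, Linked θ (p * S) (p * theta0 N x) := linked_theta0 fun x => H (.inl x)
  have hres : ∀ (k : UnitIdx N) (i : ℤ), -N1 N ≤ i → i ≤ N2 N →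
      closure (tile (p * S * T ^ k.1 * S * T ^ i)) ⊆ covered θ := by
    intro k i h1 h2
    simpa [theta1, mul_assoc] using H (.inr (.inl (k, ⟨i, h1, h2⟩)))
  have hfirst : ∀ (k : UnitIdx N) (i : ℤ), -N1 N ≤ i ∧ i ≤ N2 N →
      Linked θ (p * S) (p * S * T ^ k.1 * S * T ^ i) := by
    intro k i hi
    -- ST^k is itself in Θ₀, so the words beginning with ST^kS attach to it across an S-edge.
    have hk : -N1 N ≤ k.1 ∧ k.1 ≤ N2 N :=
      ⟨k.2.1.1, k.2.1.2.trans (by have := (zero_mem_range (N := N)).2; omega)⟩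
    have h0 := hres k 0 zero_mem_range.1 zero_mem_range.2
    have h1 := H (.inl (.inl ⟨k.1, hk⟩))
    have h2 := hbase (.inl ⟨k.1, hk⟩)
    simp only [theta1, theta0, zpow_zero, mul_one, ← mul_assoc] at h0 h1 h2
    have h3 := linked_mul_zpow (hres k) zero_mem_range hi
    rw [zpow_zero, mul_one] at h3
    exact (h2.trans (linked_mul_S h1 h0)).trans h3
  rcases y with x | ⟨k, i⟩ | ⟨k, ⟨⟨j, m⟩, hj, hg, hm⟩⟩
  · exact hbase x
  · simpa [theta1, mul_assoc] using hfirst k i.1 i.2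
  · simp only at hj hg hm
    set t := tilde N (kinv N k.1 + j) with ht
    have hinf : ∀ m' : ℤ, 0 ≤ m' → m' ≤ m →
        closure (tile (p * S * T ^ k.1 * S * T ^ t * S * T ^ m')) ⊆ covered θ := by
      intro m' h1 h2
      lift m' to ℕ using h1
      have hm' : m' ≤ Mj N (j : ZMod N) := by omega
      simpa [theta1, mul_assoc, ht] using H (.inr (.inr (k, ⟨(j, m'), hj, hg, hm'⟩)))
    have htr : -N1 N ≤ t ∧ t ≤ N2 N := tilde_mem_range _
    have h0 := hinf 0 le_rfl (by omega)
    rw [zpow_zero, mul_one] at h0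
    have h1 := (hfirst k t htr).trans (linked_mul_S (hres k t htr.1 htr.2) h0)
    have h2 := linked_mul_zpow hinf (i := 0) (j := m) (by omega) (by omega)
    rw [zpow_zero, mul_one] at h2
    simpa [theta1, mul_assoc, ht] using h1.trans h2

/-! ### The three fundamental lists -/

theorem isFundamentalList_theta0 :
    IsFundamentalList (CongruenceSubgroup.Gamma0 N) (theta0 N) := by
  refine ⟨isRightCosetReps_theta0, isConnected_domain (.inl ⟨0, zero_mem_range⟩) fun x => ?_⟩
  have h := linked_theta0 (N := N) (θ := theta0 N) (p := 1)
    (fun x => by simpa using closure_tile_subset_covered (theta0 N) x) x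
  simpa [theta0] using h

theorem isFundamentalList_theta1 (hN : 1 < N) :
    IsFundamentalList (CongruenceSubgroup.Gamma1 N) (theta1 N) := by
  refine ⟨isRightCosetReps_theta1 hN,
    isConnected_domain (.inl (.inl ⟨0, zero_mem_range⟩)) fun y => ?_⟩
  have h := linked_theta1 (N := N) (θ := theta1 N) (p := 1)
    (fun y => by simpa using closure_tile_subset_covered (theta1 N) y) y
  simpa [theta1, theta0] using h

theorem isFundamentalList_thetaFull (hN : 1 < N) :
    IsFundamentalList (CongruenceSubgroup.Gamma N) (thetaFull N) := by
  have hcov : ∀ l : ℤ, -N1 N ≤ l → l ≤ N2 N → ∀ y,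
      closure (tile (T ^ l * theta1 N y)) ⊆ covered (thetaFull N) :=
    fun l h1 h2 y => closure_tile_subset_covered (thetaFull N) (⟨l, h1, h2⟩, y)
  have hlink : ∀ l : ℤ, -N1 N ≤ l → l ≤ N2 N → ∀ y,
      Linked (thetaFull N) (T ^ l * S) (T ^ l * theta1 N y) :=
    fun l h1 h2 y => linked_theta1 (hcov l h1 h2) y
  -- The word with j = m = 0 is S² = -I, so the tile of T^ℓ belongs to the ℓ-th translate; these
  -- tiles form a connected strip joining all translates.
  let z : Idx1 N := .inl (.inr ⟨(0, 0), zero_mem_range, by simpa using hN, Nat.zero_le _⟩)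
  have hz : ∀ l : ℤ, T ^ l * theta1 N z = -1 * T ^ l := by
    intro l
    simp [z, theta1, theta0, S_mul_S]
  have hT : ∀ l : ℤ, -N1 N ≤ l ∧ l ≤ N2 N →
      Linked (thetaFull N) (-1 * T ^ (0 : ℤ)) (-1 * T ^ l) := fun l hl =>
    linked_mul_zpow (fun i h1 h2 => hz i ▸ hcov i h1 h2 z) zero_mem_range hl
  refine ⟨(isRightCosetReps_theta1 hN).T_zpow_mul,
    isConnected_domain (⟨0, zero_mem_range⟩, z) fun x => ?_⟩
  have h1 := hT x.1.1 x.1.2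
  rw [← hz, ← hz] at h1
  exact h1.trans ((hlink x.1.1 x.1.2.1 x.1.2.2 z).symm.trans (hlink x.1.1 x.1.2.1 x.1.2.2 x.2))

end Lists

end ConnFund

theorem theorem1p3 (N : ℕ) [NeZero N] (hN : 1 < N) :
    (ConnFund.IsFundamentalList (CongruenceSubgroup.Gamma0 N) (ConnFund.theta0 N) ∧
      ConnFund.IsFundamentalDomain (CongruenceSubgroup.Gamma0 N)
        (ConnFund.domain (ConnFund.theta0 N))) ∧
    (ConnFund.IsFundamentalList (CongruenceSubgroup.Gamma1 N) (ConnFund.theta1 N) ∧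
      ConnFund.IsFundamentalDomain (CongruenceSubgroup.Gamma1 N)
        (ConnFund.domain (ConnFund.theta1 N))) ∧
    (ConnFund.IsFundamentalList (CongruenceSubgroup.Gamma N) (ConnFund.thetaFull N) ∧
      ConnFund.IsFundamentalDomain (CongruenceSubgroup.Gamma N)
        (ConnFund.domain (ConnFund.thetaFull N))) := by
  have h0 := ConnFund.isFundamentalList_theta0 (N := N)
  have h1 := ConnFund.isFundamentalList_theta1 hN
  have h := ConnFund.isFundamentalList_thetaFull hN
  exact ⟨⟨h0, h0.isFundamentalDomain⟩, ⟨h1, h1.isFundamentalDomain⟩, ⟨h, h.isFundamentalDomain⟩⟩
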